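/- Let $p$ be a prime number and let $K$ be an ultrametric extension of $\mathbf{Q}_p$, that is, an extension field of $\mathbf{Q}_p$ (not assumed complete) with an ultrametric absolute value $|\cdot|$ extending the $p$-adic one. Let $R=\{x\in K : |x|\le 1\}$ be its ring of integers. Let $d\ge 0$ be an integer, and let $\zeta$ be a root of unity of order exactly $p^{d+1}$ in a finite extension $L$ of $K$, endowed with an ultrametric absolute value extending that of $K$. Let $\mathcal{O}_{K(\zeta)}=\{x\in K(\zeta) : |x|\le 1\}$ be the ring of integers of $K(\zeta)$. Let $P(T)=a_0T+a_1T^p+\dots+a_dT^{p^d}$ be a $p$-typical polynomial of degree at most $p^d$ with coefficients in $K$, and put $$\widetilde P(T)=\frac{a_0}{\zeta-1}\,T+\frac{a_1}{\zeta^{p}-1}\,T^{p}+\dots+\frac{a_d}{\zeta^{p^d}-1}\,T^{p^d}.$$ Then the following three conditions are equivalent: 1. the radius of convergence of the power series $\exp(P(T))$ is at least $1$; 2. all the coefficients of $\exp(P(T))$ lie in $R$; 3. the coefficients of the power series $\exp(\widetilde P(T))$ lie in $\mathcal{O}_{K(\zeta)}$ in all degrees up to and including $p^d$. -/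

import Mathlib

open scoped Polynomial PowerSeries IntermediateField

noncomputable section

/-- The ring of integers of an ultrametric field: its closed unit ball, as a subring. -/
def integers (K : Type*) [NormedField K] [IsUltrametricDist K] : Subring K :=
  (NormedField.valuation (K := K)).integer

theorem mem_integers {K : Type*} [NormedField K] [IsUltrametricDist K] (x : K) :
    x ∈ integers K ↔ ‖x‖ ≤ 1 := by
  rw [integers, Valuation.mem_integer_iff, NormedField.valuation_apply, ← NNReal.coe_le_coe]
  simp

/-- For a normed extension `L` of `K` and `ζ` in `L`, the ring of integers of the field `K(ζ)`
(for the absolute value induced by `L`), as a subring of `L`. -/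
def integersAdjoin (K : Type*) {L : Type*} [NormedField K] [NormedField L] [IsUltrametricDist L]
    [NormedAlgebra K L] (ζ : L) : Subring L :=
  integers L ⊓ K⟮ζ⟯.toSubring

/-- The `p`-typical polynomial `a₀ T + a₁ T ^ p + ⋯ + a_d T ^ (p ^ d)`. -/
def pTypical {K : Type*} [Field K] (p d : ℕ) (a : Fin (d + 1) → K) : K[X] :=
  ∑ i : Fin (d + 1), Polynomial.monomial (p ^ (i : ℕ)) (a i)

/-- The formal power series `exp (P(T))`, for a polynomial `P` without constant term. -/
def expPoly {K : Type*} [Field K] [CharZero K] (P : K[X]) : K⟦X⟧ :=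
  (PowerSeries.exp K).subst (P : K⟦X⟧)

/-- The radius of convergence, in `[0, ∞]`, of a formal power series in one variable. -/
def radiusOfConvergence {K : Type*} [NontriviallyNormedField K] (f : K⟦X⟧) : ENNReal :=
  (FormalMultilinearSeries.ofScalars K fun n => PowerSeries.coeff n f).radius

end

open scoped Polynomial PowerSeries IntermediateField

/-! Let AH(T) = exp(T + T^p/p + T^(p^2)/p^2 + ⋯), which is p-integral by Dwork's lemma. Up to degree
p^d, exp(P̃) agrees with F = ∏_{j ≤ d} AH(y_j T^(p^j)), where the y_j are given by `wittCoord`.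
Peeling off factors shows that F is integral in degrees ≤ p^d exactly when every |y_j| ≤ 1, so this
is what (3) says. Moreover F(ζT) = F(T) exp(P(T)) exactly: passing from log F(T) to log F(ζT) − log
F(T) multiplies the coefficient of T^(p^i) by ζ^(p^i) − 1, which restores a_i for i ≤ d and kills
the tail i > d. Hence (3) gives (2) by division, and (2) gives (1) at once.

The implication (1) ⇒ (3) rests on `norm_le_one_of_rescale_eq`. If some |y_j| > 1, let r > 1 be the
maximum of the |y_j|^(1/p^j), first attained at J, and split F = F₀F₁ before the factor J. Since F₀
grows more slowly than r^n, (1) forces H = F₁(ζT)/F₁(T) to be O(s^n) for some s < r. With π =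
ζ^(p^J) − 1, however, H equals 1 + π p^(-J) T F₁'/F₁ up to an error of size |π|² r^n, and the linear
term has size exactly |π| r^n in the degrees n = p^m, m ≥ d. As |π| < 1, this is a contradiction. -/

theorem norm_sub_le_max_of_ultrametric {E : Type*} [SeminormedAddCommGroup E] [IsUltrametricDist E]
    (x y : E) : ‖x - y‖ ≤ max ‖x‖ ‖y‖ := by
  simpa [sub_eq_add_neg] using IsUltrametricDist.norm_add_le_max x (-y)

/-! ### Exponentials of power series through the logarithmic derivative -/

open PowerSeries in
/-- `f` is the exponential of `g - g(0)`: it has constant coefficient `1` and logarithmic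
derivative `g'`. -/
def IsExpOf {k : Type*} [CommRing k] (g f : k⟦X⟧) : Prop :=
  constantCoeff f = 1 ∧ d⁄dX k f = d⁄dX k g * f

namespace IsExpOf

open PowerSeries

section CommRing

variable {k : Type*} [CommRing k] {g g' f f' : k⟦X⟧}

theorem zero : IsExpOf (0 : k⟦X⟧) 1 := by
  constructor
  · simp
  · rw [derivative_one, map_zero, zero_mul]

theorem mul (h : IsExpOf g f) (h' : IsExpOf g' f') : IsExpOf (g + g') (f * f') := by
  refine ⟨by rw [map_mul, h.1, h'.1, one_mul], ?_⟩
  rw [Derivation.leibniz, h.2, h'.2, map_add, smul_eq_mul, smul_eq_mul]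
  ring

theorem prod {ι : Type*} (s : Finset ι) {g f : ι → k⟦X⟧} (h : ∀ i ∈ s, IsExpOf (g i) (f i)) :
    IsExpOf (∑ i ∈ s, g i) (∏ i ∈ s, f i) := by
  classical
  induction s using Finset.induction_on with
  | empty => simpa using zero
  | insert a s ha ih =>
    rw [Finset.sum_insert ha, Finset.prod_insert ha]
    exact (h a (by simp)).mul (ih fun i hi => h i (by simp [hi]))

theorem pow (h : IsExpOf g f) (n : ℕ) : IsExpOf ((n : k⟦X⟧) * g) (f ^ n) := by
  simpa using prod (Finset.range n) (fun _ _ => h)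

theorem rescale (h : IsExpOf g f) (c : k) :
    IsExpOf (PowerSeries.rescale c g) (PowerSeries.rescale c f) := by
  have key (u : k⟦X⟧) :
      d⁄dX k (PowerSeries.rescale c u) = C c * PowerSeries.rescale c (d⁄dX k u) := by
    ext n
    simp only [coeff_derivative, coeff_rescale, coeff_C_mul]
    ring
  refine ⟨?_, ?_⟩
  · rw [← coeff_zero_eq_constantCoeff_apply, coeff_rescale, coeff_zero_eq_constantCoeff_apply, h.1]
    simp
  · rw [key, key, h.2, map_mul]
    ring

theorem expand (h : IsExpOf g f) {q : ℕ} (hq : q ≠ 0) :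
    IsExpOf (PowerSeries.expand q hq g) (PowerSeries.expand q hq f) := by
  refine ⟨by rw [constantCoeff_expand, h.1], ?_⟩
  have hs : HasSubst (X ^ q : k⟦X⟧) := HasSubst.X_pow hq
  simp only [expand_apply]
  rw [derivative_subst hs, derivative_subst hs, h.2, subst_mul hs]
  ring

theorem map {k' : Type*} [CommRing k'] (h : IsExpOf g f) (φ : k →+* k') :
    IsExpOf (PowerSeries.map φ g) (PowerSeries.map φ f) := by
  have key (u : k⟦X⟧) : d⁄dX k' (PowerSeries.map φ u) = PowerSeries.map φ (d⁄dX k u) := by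
    ext n
    simp [coeff_derivative]
  refine ⟨?_, by rw [key, key, h.2, map_mul]⟩
  rw [← coeff_zero_eq_constantCoeff_apply, coeff_map, coeff_zero_eq_constantCoeff_apply, h.1,
    map_one]

theorem coeff_zero (h : IsExpOf g f) : coeff 0 f = 1 := by
  rw [coeff_zero_eq_constantCoeff_apply, h.1]

theorem succ_mul_coeff (h : IsExpOf g f) (n : ℕ) :
    ((n + 1 : ℕ) : k) * coeff (n + 1) f =
      ∑ ij ∈ Finset.HasAntidiagonal.antidiagonal n, ((ij.1 + 1 : ℕ) : k) * coeff (ij.1 + 1) g * coeff ij.2 f := by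
  have := congrArg (coeff n) h.2
  rw [coeff_derivative, coeff_mul] at this
  push_cast
  rw [mul_comm, this]
  refine Finset.sum_congr rfl fun ij _ => ?_
  rw [coeff_derivative, mul_comm (coeff _ g)]

theorem subst_exp [Algebra ℚ k] (hg : constantCoeff g = 0) :
    IsExpOf g ((PowerSeries.exp k).subst g) := by
  have hs : HasSubst g := HasSubst.of_constantCoeff_zero' hg
  refine ⟨?_, ?_⟩
  · rw [← coeff_zero_eq_constantCoeff_apply, coeff_subst' hs, finsum_eq_single _ 0]
    · simp
    · intro n hn
      simp [hg, hn]
  · rw [derivative_subst hs, derivative_exp, mul_comm]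

end CommRing

section Field

variable {k : Type*} [Field k] [CharZero k] {g g' f f' : k⟦X⟧}

/-- In characteristic zero the recursion `succ_mul_coeff` can be solved degree by degree. Identities
between exponentials thus reduce to identities between logarithms, even after truncation. -/
theorem coeff_congr (h : IsExpOf g f) (h' : IsExpOf g' f') (N : ℕ)
    (hg : ∀ n ≤ N, n ≠ 0 → coeff n g = coeff n g') : ∀ n ≤ N, coeff n f = coeff n f' := by
  intro n
  induction n using Nat.strong_induction_on with
  | _ n ih =>
    intro hn
    cases n with
    | zero => rw [h.coeff_zero, h'.coeff_zero]
    | succ n =>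
      have hne : ((n + 1 : ℕ) : k) ≠ 0 := Nat.cast_ne_zero.2 n.succ_ne_zero
      apply mul_left_cancel₀ hne
      rw [h.succ_mul_coeff, h'.succ_mul_coeff]
      refine Finset.sum_congr rfl fun ij hij => ?_
      have := Finset.HasAntidiagonal.mem_antidiagonal.1 hij
      rw [hg _ (by omega) (by omega), ih ij.2 (by omega) (by omega)]

theorem unique (h : IsExpOf g f) (h' : IsExpOf g f') : f = f' := by
  ext n
  exact h.coeff_congr h' n (fun _ _ _ => rfl) n le_rfl

/-- The leading term of an exponential. -/
theorem coeff_eq_of_forall_lt (h : IsExpOf g f) {n : ℕ} (hn : n ≠ 0)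
    (hg : ∀ m < n, m ≠ 0 → coeff m g = 0) : coeff n f = coeff n g := by
  obtain ⟨n, rfl⟩ := Nat.exists_eq_succ_of_ne_zero hn
  have hne : ((n + 1 : ℕ) : k) ≠ 0 := Nat.cast_ne_zero.2 n.succ_ne_zero
  apply mul_left_cancel₀ hne
  rw [Nat.succ_eq_add_one, h.succ_mul_coeff, Finset.sum_eq_single (n, 0)]
  · rw [h.coeff_zero, mul_one]
  · rintro ⟨i, j⟩ hij hne'
    have := Finset.HasAntidiagonal.mem_antidiagonal.1 hij
    have hj : j ≠ 0 := by
      rintro rfl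
      exact hne' (by simp_all)
    rw [hg _ (by simp only at this ⊢; omega) (by simp), mul_zero, zero_mul]
  · simp

theorem coeff_eq_zero_of_not_dvd (h : IsExpOf g f) {q : ℕ}
    (hg : ∀ n, ¬ q ∣ n → coeff n g = 0) : ∀ n, ¬ q ∣ n → coeff n f = 0 := by
  intro n
  induction n using Nat.strong_induction_on with
  | _ n ih =>
    intro hn
    cases n with
    | zero => exact absurd (dvd_zero q) hn
    | succ n =>
      have hne : ((n + 1 : ℕ) : k) ≠ 0 := Nat.cast_ne_zero.2 n.succ_ne_zero
      apply mul_left_cancel₀ hne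
      rw [h.succ_mul_coeff, mul_zero]
      refine Finset.sum_eq_zero fun ij hij => ?_
      have hs := Finset.HasAntidiagonal.mem_antidiagonal.1 hij
      by_cases hq : q ∣ ij.1 + 1
      · rw [ih ij.2 (by omega) fun h2 => hn ?_, mul_zero]
        rw [← hs, add_right_comm]
        exact dvd_add hq h2
      · rw [hg _ hq, mul_zero, zero_mul]

theorem coeff_mem (h : IsExpOf g f) {S : Subfield k} (hg : ∀ n, coeff n g ∈ S) (n : ℕ) :
    coeff n f ∈ S := by
  induction n using Nat.strong_induction_on with
  | _ n ih =>
    cases n with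
    | zero => rw [h.coeff_zero]; exact S.one_mem
    | succ n =>
      have hne : ((n + 1 : ℕ) : k) ≠ 0 := Nat.cast_ne_zero.2 n.succ_ne_zero
      rw [← mul_div_cancel_left₀ (coeff (n + 1) f) hne, h.succ_mul_coeff]
      refine S.div_mem (S.sum_mem fun ij hij => ?_) (natCast_mem S _)
      have hs := Finset.HasAntidiagonal.mem_antidiagonal.1 hij
      exact S.mul_mem (S.mul_mem (natCast_mem S _) (hg _)) (ih ij.2 (by omega))

end Field

end IsExpOf

/-! ### Dwork's integrality criterion -/

open PowerSeries in
/-- **Dwork's lemma**. -/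
theorem norm_coeff_le_one_of_pow_eq_expand_mul {p : ℕ} [Fact p.Prime] {f u : ℚ_[p]⟦X⟧}
    (hf : constantCoeff f = 1) (hu : constantCoeff u = 1)
    (hu' : ∀ n ≠ 0, ‖coeff n u‖ ≤ (p : ℝ)⁻¹)
    (h : f ^ p = expand p (NeZero.ne p) f * u) (n : ℕ) : ‖coeff n f‖ ≤ 1 := by
  have hp0 : (0 : ℝ) < p := by exact_mod_cast (Fact.out : p.Prime).pos
  have hp1 : (p : ℝ)⁻¹ ≤ 1 := inv_le_one_of_one_le₀ (by exact_mod_cast (Fact.out : p.Prime).one_le)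
  induction n using Nat.strong_induction_on with
  | _ n ih =>
    rcases Nat.eq_zero_or_pos n with rfl | hn
    · simp [hf]
    have hex : ∀ i, ∃ c : ℤ_[p], i < n → (c : ℚ_[p]) = coeff i f := fun i => by
      by_cases hi : i < n
      · exact ⟨⟨_, ih i hi⟩, fun _ => rfl⟩
      · exact ⟨0, fun h => absurd h hi⟩
    choose c hc using hex
    -- The part of f below degree n is integral by induction; lifting it to ℤ_p allows reduction mod
    -- p.
    let t : ℤ_[p][X] := ∑ i ∈ Finset.range n, Polynomial.monomial i (c i)
    have ht (i : ℕ) : t.coeff i = if i < n then c i else 0 := by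
      simp [t, Polynomial.finsetSum_coeff, Polynomial.coeff_monomial]
    let φ : ℤ_[p] →+* ℚ_[p] := PadicInt.Coe.ringHom
    let T : ℚ_[p]⟦X⟧ := (t.map φ : ℚ_[p][X])
    have hT (i : ℕ) : coeff i T = if i < n then coeff i f else 0 := by
      simp only [T, Polynomial.coeff_coe, Polynomial.coeff_map, ht]
      split_ifs with hi
      · exact hc i hi
      · exact map_zero φ
    obtain ⟨w, hw⟩ : X ^ n ∣ f - T := by
      rw [X_pow_dvd_iff]
      intro m hm
      rw [map_sub, hT, if_pos hm, sub_self]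
    have hw0 : constantCoeff w = coeff n f := by
      have := congrArg (coeff n) hw
      rw [map_sub, hT, if_neg (lt_irrefl n), sub_zero] at this
      rw [this]
      simpa using (coeff_X_pow_mul w n 0).symm
    have hT0 : constantCoeff T = 1 := by
      rw [← coeff_zero_eq_constantCoeff_apply, hT, if_pos hn, coeff_zero_eq_constantCoeff_apply, hf]
    -- The unknown coefficient enters f^p linearly, with factor p, because both constant terms are
    -- 1.
    have h1 : coeff n (f ^ p) = coeff n (T ^ p) + p * coeff n f := by
      have hg := Commute.mul_geom_sum₂ (Commute.all f T) p
      have : f ^ p = T ^ p + X ^ n * (w * ∑ i ∈ Finset.range p, f ^ i * T ^ (p - 1 - i)) := by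
        rw [← mul_assoc, ← hw, hg]; ring
      rw [this, map_add]
      congr 1
      have h0 := coeff_X_pow_mul (w * ∑ i ∈ Finset.range p, f ^ i * T ^ (p - 1 - i)) n 0
      rw [zero_add] at h0
      rw [h0, coeff_zero_eq_constantCoeff_apply, map_mul, hw0, map_sum]
      simp [hf, hT0, mul_comm]
    have h2 : ‖coeff n (f ^ p) - coeff n (expand p (NeZero.ne p) f)‖ ≤ (p : ℝ)⁻¹ := by
      have hmem : (n, 0) ∈ Finset.HasAntidiagonal.antidiagonal n := by simp
      rw [h, coeff_mul, ← Finset.add_sum_erase _ _ hmem]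
      simp only [coeff_zero_eq_constantCoeff_apply, hu, mul_one, add_sub_cancel_left]
      refine IsUltrametricDist.norm_sum_le_of_forall_le_of_nonneg (by positivity) ?_
      rintro ⟨i, j⟩ hij
      simp only [Finset.mem_erase, Finset.HasAntidiagonal.mem_antidiagonal, ne_eq, Prod.mk.injEq] at hij
      have hj : j ≠ 0 := fun hj => hij.1 ⟨by omega, hj⟩
      rw [norm_mul, ← one_mul (p : ℝ)⁻¹]
      refine mul_le_mul ?_ (hu' j hj) (norm_nonneg _) zero_le_one
      rw [coeff_expand]
      split_ifs
      · exact ih _ (lt_of_le_of_lt (Nat.div_le_self _ _) (by omega))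
      · simp
    have h3 : coeff n (expand p (NeZero.ne p) f) = φ ((Polynomial.expand _ p t).coeff n) := by
      rw [coeff_expand, Polynomial.coeff_expand (Fact.out : p.Prime).pos]
      split_ifs with hd
      · have hlt : n / p < n := Nat.div_lt_self hn (Fact.out : p.Prime).one_lt
        rw [ht, if_pos hlt]
        exact (hc _ hlt).symm
      · simp
    have h4 : coeff n (T ^ p) = φ ((t ^ p).coeff n) := by
      rw [← Polynomial.coe_pow, ← Polynomial.map_pow, Polynomial.coeff_coe, Polynomial.coeff_map]
    have h5 : ‖coeff n (T ^ p) - coeff n (expand p (NeZero.ne p) f)‖ ≤ (p : ℝ)⁻¹ := by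
      rw [h3, h4, ← map_sub]
      -- Frobenius: t(X)^p = t(X^p) over 𝔽_p.
      have hz : PadicInt.toZMod ((t ^ p).coeff n - (Polynomial.expand _ p t).coeff n) = 0 := by
        rw [map_sub, ← Polynomial.coeff_map, ← Polynomial.coeff_map, Polynomial.map_pow,
          Polynomial.map_expand, ZMod.expand_card, sub_self]
      rw [← RingHom.mem_ker, PadicInt.ker_toZMod, PadicInt.maximalIdeal_eq_span_p,
        Ideal.mem_span_singleton] at hz
      obtain ⟨z, hz⟩ := hz
      rw [hz, map_mul, norm_mul]
      have : ‖φ (p : ℤ_[p])‖ = (p : ℝ)⁻¹ := by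
        rw [map_natCast]; exact Padic.norm_p
      rw [this]
      exact mul_le_of_le_one_right (by positivity) z.2
    have h6 : ‖(p : ℚ_[p]) * coeff n f‖ ≤ (p : ℝ)⁻¹ := by
      have : (p : ℚ_[p]) * coeff n f =
          (coeff n (f ^ p) - coeff n (expand p (NeZero.ne p) f)) -
          (coeff n (T ^ p) - coeff n (expand p (NeZero.ne p) f)) := by rw [h1]; ring
      rw [this]
      exact (norm_sub_le_max_of_ultrametric _ _).trans (max_le h2 h5)
    rw [norm_mul, Padic.norm_p] at h6
    exact le_of_mul_le_mul_left (by simpa using h6) (inv_pos.2 hp0)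

theorem norm_prime_pow_div_factorial_le {p : ℕ} [Fact p.Prime] {n : ℕ} (hn : n ≠ 0) :
    ‖(p : ℚ_[p]) ^ n / (n.factorial : ℚ_[p])‖ ≤ (p : ℝ)⁻¹ := by
  have hp : (1 : ℝ) < p := by exact_mod_cast (Fact.out : p.Prime).one_lt
  have hlt : padicValNat p n.factorial < n := padicValNat_factorial_lt_of_ne_zero p hn
  rw [norm_div, norm_pow, Padic.norm_p,
    Padic.norm_eq_zpow_neg_valuation (Nat.cast_ne_zero.2 n.factorial_ne_zero),
    Padic.valuation_natCast, ← zpow_natCast, ← zpow_neg_one, ← zpow_mul, ← zpow_sub₀ (by positivity)]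
  exact zpow_le_zpow_right₀ hp.le (by omega)

/-! ### The Artin-Hasse exponential and its integrality -/

open Classical in
/-- The `p`-typical series `T + T ^ p / p + T ^ (p ^ 2) / p ^ 2 + ⋯`, the logarithm of the
Artin-Hasse exponential. -/
noncomputable def artinHasseLog (k : Type*) [Field k] (p : ℕ) : k⟦X⟧ :=
  PowerSeries.mk fun n => if ∃ i, n = p ^ i then (n : k)⁻¹ else 0

namespace artinHasseLog

open PowerSeries

theorem coeff_pow (k : Type*) [Field k] (p i : ℕ) :
    coeff (p ^ i) (artinHasseLog k p) = ((p : k) ^ i)⁻¹ := by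
  rw [artinHasseLog, coeff_mk, if_pos ⟨i, rfl⟩, Nat.cast_pow]

theorem coeff_of_ne (k : Type*) [Field k] {p n : ℕ} (h : ∀ i, n ≠ p ^ i) :
    coeff n (artinHasseLog k p) = 0 := by
  rw [artinHasseLog, coeff_mk, if_neg (by simpa using h)]

theorem constantCoeff (k : Type*) [Field k] (p : ℕ) [hp : Fact p.Prime] :
    PowerSeries.constantCoeff (artinHasseLog k p) = 0 := by
  rw [← coeff_zero_eq_constantCoeff_apply]
  exact coeff_of_ne k fun i => (pow_pos hp.out.pos i).ne

theorem map {k k' : Type*} [Field k] [Field k'] (p : ℕ) (φ : k →+* k') :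
    PowerSeries.map φ (artinHasseLog k p) = artinHasseLog k' p := by
  ext n
  simp only [artinHasseLog, coeff_map, coeff_mk]
  split_ifs <;> simp

theorem expand_add (k : Type*) [Field k] [CharZero k] (p : ℕ) [hp : Fact p.Prime] :
    PowerSeries.expand p (NeZero.ne p) (artinHasseLog k p) + (p : k⟦X⟧) * X =
      (p : k⟦X⟧) * artinHasseLog k p := by
  have hpk : (p : k) ≠ 0 := Nat.cast_ne_zero.2 hp.out.ne_zero
  have hC : (p : k⟦X⟧) = C (p : k) := (map_natCast C p).symm
  ext n
  rw [map_add, hC, coeff_C_mul, coeff_C_mul, coeff_expand, coeff_X]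
  by_cases hn : ∃ i, n = p ^ i
  · obtain ⟨i, rfl⟩ := hn
    rw [coeff_pow]
    cases i with
    | zero => simp [hp.out.ne_one]
    | succ i =>
      rw [if_pos (dvd_pow_self p i.succ_ne_zero), if_neg, pow_succ, Nat.mul_div_cancel _ hp.out.pos,
        coeff_pow, pow_succ]
      · field_simp; simp
      · exact (Nat.one_lt_pow i.succ_ne_zero hp.out.one_lt).ne'
  · push Not at hn
    have h1 : n ≠ 1 := by simpa using hn 0
    rw [coeff_of_ne k hn, if_neg h1]
    split_ifs with hd
    · rw [coeff_of_ne k, mul_zero, add_zero]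
      intro i hi
      apply hn (i + 1)
      rw [pow_succ, ← hi, Nat.div_mul_cancel hd]
    · simp

end artinHasseLog

/-- The Artin-Hasse exponential. -/
noncomputable def artinHasseExp (k : Type*) [Field k] [CharZero k] (p : ℕ) : k⟦X⟧ :=
  (PowerSeries.exp k).subst (artinHasseLog k p)

theorem isExpOf_artinHasseExp (k : Type*) [Field k] [CharZero k] (p : ℕ) [Fact p.Prime] :
    IsExpOf (artinHasseLog k p) (artinHasseExp k p) :=
  IsExpOf.subst_exp (artinHasseLog.constantCoeff k p)

-- The functional equation `artinHasseLog.expand_add` exponentiates to AH(T)^p = AH(T^p) exp(pT),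
-- and p^n/n! is divisible by p for n > 0, so Dwork's lemma applies.
open PowerSeries in
theorem norm_coeff_artinHasseExp_padic_le (p : ℕ) [Fact p.Prime] (n : ℕ) :
    ‖coeff n (artinHasseExp ℚ_[p] p)‖ ≤ 1 := by
  have hE := isExpOf_artinHasseExp ℚ_[p] p
  have hX : IsExpOf (X : ℚ_[p]⟦X⟧) (exp ℚ_[p]) := by
    refine ⟨constantCoeff_exp, ?_⟩
    rw [derivative_exp, derivative_X, one_mul]
  have hpX := hX.rescale (p : ℚ_[p])
  rw [rescale_X, map_natCast] at hpX
  refine norm_coeff_le_one_of_pow_eq_expand_mul hE.1 hpX.1 ?_ ?_ n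
  · intro m hm
    simpa [coeff_rescale, coeff_exp, div_eq_mul_inv] using
      norm_prime_pow_div_factorial_le (p := p) hm
  · refine (hE.pow p).unique ?_
    rw [← artinHasseLog.expand_add]
    exact (hE.expand _).mul hpX

theorem norm_coeff_artinHasseExp_le {p : ℕ} [Fact p.Prime] {k : Type*} [NormedField k] [CharZero k]
    [NormedAlgebra ℚ_[p] k] (n : ℕ) : ‖PowerSeries.coeff n (artinHasseExp k p)‖ ≤ 1 := by
  have h := (isExpOf_artinHasseExp ℚ_[p] p).map (algebraMap ℚ_[p] k)
  rw [artinHasseLog.map] at h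
  rw [(isExpOf_artinHasseExp k p).unique h, PowerSeries.coeff_map, norm_algebraMap']
  exact norm_coeff_artinHasseExp_padic_le p n

/-! ### Ultrametric growth estimates -/

section Growth

open PowerSeries

variable {L : Type*} [NormedField L] [IsUltrametricDist L]

theorem norm_coeff_mul_le {f g : L⟦X⟧} {s : ℝ} (hs : 0 ≤ s) {B C : ℝ} (hB : 0 ≤ B) (hC : 0 ≤ C)
    (hf : ∀ n, ‖coeff n f‖ ≤ B * s ^ n) (hg : ∀ n, ‖coeff n g‖ ≤ C * s ^ n) (n : ℕ) :
    ‖coeff n (f * g)‖ ≤ B * C * s ^ n := by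
  rw [coeff_mul]
  refine IsUltrametricDist.norm_sum_le_of_forall_le_of_nonneg (by positivity) fun ij hij => ?_
  rw [← Finset.HasAntidiagonal.mem_antidiagonal.1 hij, norm_mul, pow_add]
  calc _ ≤ (B * s ^ ij.1) * (C * s ^ ij.2) :=
        mul_le_mul (hf _) (hg _) (norm_nonneg _) (by positivity)
    _ = _ := by ring

theorem norm_coeff_prod_le {ι : Type*} (S : Finset ι) {f : ι → L⟦X⟧} {s : ℝ} (hs : 0 ≤ s)
    (hf : ∀ i ∈ S, ∀ n, ‖coeff n (f i)‖ ≤ s ^ n) (n : ℕ) :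
    ‖coeff n (∏ i ∈ S, f i)‖ ≤ s ^ n := by
  classical
  induction S using Finset.induction_on generalizing n with
  | empty =>
    rw [Finset.prod_empty, coeff_one]
    split_ifs with h
    · simp [h]
    · simpa using pow_nonneg hs n
  | insert a S ha ih =>
    rw [Finset.prod_insert ha]
    simpa using norm_coeff_mul_le hs zero_le_one zero_le_one
      (fun n => by simpa using hf a (by simp) n)
      (fun n => by simpa using ih (fun i hi => hf i (by simp [hi])) n) n

/-- Division by a series with constant term 1 is a triangular recursion, so it keeps the bound, and
degrees up to N involve no higher ones. -/
theorem norm_coeff_le_of_mul {f h : L⟦X⟧} {s C : ℝ} (hs : 0 ≤ s) (hC : 0 ≤ C)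
    (hf0 : constantCoeff f = 1) (hf : ∀ n, ‖coeff n f‖ ≤ s ^ n) {N : ℕ}
    (hg : ∀ n ≤ N, ‖coeff n (f * h)‖ ≤ C * s ^ n) : ∀ n ≤ N, ‖coeff n h‖ ≤ C * s ^ n := by
  intro n
  induction n using Nat.strong_induction_on with
  | _ n ih =>
    intro hn
    have hmem : (0, n) ∈ Finset.HasAntidiagonal.antidiagonal n := by simp
    have key := hg n hn
    have hsum := coeff_mul n f h
    rw [← Finset.add_sum_erase _ _ hmem] at hsum
    simp only [coeff_zero_eq_constantCoeff_apply, hf0, one_mul] at hsum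
    rw [eq_comm, ← eq_sub_iff_add_eq] at hsum
    rw [hsum]
    refine (norm_sub_le_max_of_ultrametric _ _).trans (max_le key ?_)
    refine IsUltrametricDist.norm_sum_le_of_forall_le_of_nonneg (by positivity) ?_
    rintro ⟨i, j⟩ hij
    simp only [Finset.mem_erase, Finset.HasAntidiagonal.mem_antidiagonal, ne_eq, Prod.mk.injEq]
      at hij
    have hj : j < n := by
      by_contra hj
      exact hij.1 ⟨by omega, by omega⟩
    rw [norm_mul, ← hij.2, pow_add]
    calc _ ≤ s ^ i * (C * s ^ j) := mul_le_mul (hf _) (ih j hj (by omega)) (norm_nonneg _)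
          (by positivity)
      _ = _ := by ring

omit [IsUltrametricDist L] in
theorem norm_coeff_rescale_of_norm_eq_one {ζ : L} (hζ : ‖ζ‖ = 1) (f : L⟦X⟧) (n : ℕ) :
    ‖coeff n (rescale ζ f)‖ = ‖coeff n f‖ := by
  rw [coeff_rescale, norm_mul, norm_pow, hζ, one_pow, one_mul]

omit [IsUltrametricDist L] in
theorem coeff_X_mul_derivative (f : L⟦X⟧) (n : ℕ) :
    coeff n (X * d⁄dX L f) = n * coeff n f := by
  cases n with
  | zero => simp
  | succ n =>
    rw [coeff_succ_X_mul, coeff_derivative, mul_comm]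
    push_cast
    rfl

theorem norm_one_add_pow_sub_le {x : L} (hx : ‖x‖ ≤ 1) (m : ℕ) :
    ‖(1 + x) ^ m - 1 - m * x‖ ≤ ‖x‖ ^ 2 := by
  induction m with
  | zero => simp
  | succ m ih =>
    have : (1 + x) ^ (m + 1) - 1 - ((m + 1 : ℕ) : L) * x =
        ((1 + x) ^ m - 1 - m * x) * (1 + x) + m * x ^ 2 := by push_cast; ring
    rw [this]
    refine (IsUltrametricDist.norm_add_le_max _ _).trans (max_le ?_ ?_)
    · rw [norm_mul]
      refine (mul_le_of_le_one_right (norm_nonneg _) ?_).trans ih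
      exact (IsUltrametricDist.norm_add_le_max _ _).trans (by simp [hx])
    · rw [norm_mul, norm_pow]
      exact mul_le_of_le_one_left (by positivity) (IsUltrametricDist.norm_natCast_le_one L m)

/-- Modulo p, (x − 1)^(p^m) is x^(p^m) − 1 = 0 up to sign, so a power of x − 1 has norm less than 1.
-/
theorem norm_sub_one_lt_one_of_pow_eq_one {p : ℕ} [hp : Fact p.Prime] (hpL : ‖(p : L)‖ < 1) {x : L}
    {m : ℕ} (hx : x ^ p ^ m = 1) : ‖x - 1‖ < 1 := by
  have hx1 : ‖x‖ ≤ 1 := by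
    have : ‖x‖ ^ p ^ m = 1 := by rw [← norm_pow, hx, norm_one]
    exact (pow_le_one_iff_of_nonneg (norm_nonneg _) (pow_pos hp.out.pos m).ne').1 this.le
  have hz : x - 1 ∈ integers L := by
    rw [mem_integers]
    exact (norm_sub_le_max_of_ultrametric _ _).trans (by simp [hx1])
  obtain ⟨r, hr⟩ := exists_add_pow_prime_pow_eq hp.out (1 : integers L) ⟨x - 1, hz⟩ m
  have hr' := congrArg (Subtype.val) hr
  push_cast at hr'
  rw [add_sub_cancel, hx, one_pow, mul_one] at hr'
  have : (x - 1) ^ p ^ m = -((p : L) * ((x - 1) * r)) := by linear_combination -hr'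
  have hlt : ‖x - 1‖ ^ p ^ m < 1 := by
    rw [← norm_pow, this, norm_neg, norm_mul, norm_mul]
    refine mul_lt_one_of_nonneg_of_lt_one_left (norm_nonneg _) hpL ?_
    exact mul_le_one₀ ((mem_integers _).1 hz) (norm_nonneg _) ((mem_integers _).1 r.2)
  exact (pow_lt_one_iff_of_nonneg (norm_nonneg _) (pow_pos hp.out.pos m).ne').1 hlt

end Growth

/-! ### Products of Artin-Hasse factors and Witt coordinates -/

section WittCoordinates

open PowerSeries

variable {L : Type*} [Field L] [CharZero L] (p : ℕ) [hp : Fact p.Prime]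

/-- The series `log AH(y T ^ (p ^ j))`, for `AH` the Artin-Hasse exponential. -/
noncomputable def artinHasseFactorLog (y : L) (j : ℕ) : L⟦X⟧ :=
  expand (p ^ j) (pow_ne_zero j hp.out.ne_zero) (rescale y (artinHasseLog L p))

/-- The series `AH(y T ^ (p ^ j))`, for `AH` the Artin-Hasse exponential. -/
noncomputable def artinHasseFactor (y : L) (j : ℕ) : L⟦X⟧ :=
  expand (p ^ j) (pow_ne_zero j hp.out.ne_zero) (rescale y (artinHasseExp L p))

/-- The product of the `AH(y_j T ^ (p ^ j))` for `j` in `S`, where `AH` is the Artin-Hasse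
exponential. -/
noncomputable def artinHasseProd (y : ℕ → L) (S : Finset ℕ) : L⟦X⟧ :=
  ∏ j ∈ S, artinHasseFactor p (y j) j

/-- The logarithm of `artinHasseProd`. -/
noncomputable def artinHasseSum (y : ℕ → L) (S : Finset ℕ) : L⟦X⟧ :=
  ∑ j ∈ S, artinHasseFactorLog p (y j) j

theorem isExpOf_artinHasseProd (y : ℕ → L) (S : Finset ℕ) :
    IsExpOf (artinHasseSum p y S) (artinHasseProd p y S) :=
  IsExpOf.prod _ fun j _ => ((isExpOf_artinHasseExp L p).rescale (y j)).expand _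

omit [CharZero L] in
theorem coeff_pow_artinHasseFactorLog (y : L) (i j : ℕ) :
    coeff (p ^ i) (artinHasseFactorLog p y j) =
      if j ≤ i then y ^ p ^ (i - j) / (p : L) ^ (i - j) else 0 := by
  rw [artinHasseFactorLog, coeff_expand]
  by_cases h : j ≤ i
  · rw [if_pos h, if_pos (pow_dvd_pow p h), Nat.pow_div h hp.out.pos, coeff_rescale,
      artinHasseLog.coeff_pow, div_eq_mul_inv]
  · rw [if_neg h, if_neg]
    rwa [Nat.pow_dvd_pow_iff_le_right hp.out.one_lt]

omit [CharZero L] in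
theorem coeff_artinHasseFactorLog_of_ne (y : L) (j : ℕ) {n : ℕ} (hn : ∀ i, n ≠ p ^ i) :
    coeff n (artinHasseFactorLog p y j) = 0 := by
  rw [artinHasseFactorLog, coeff_expand]
  split_ifs with hd
  · rw [coeff_rescale, artinHasseLog.coeff_of_ne, mul_zero]
    intro i hi
    apply hn (i + j)
    rw [pow_add, ← hi, Nat.div_mul_cancel hd]
  · rfl

omit [CharZero L] in
theorem coeff_artinHasseFactorLog_of_not_dvd (y : L) {j m n : ℕ} (hm : m ≤ j) (hn : ¬ p ^ m ∣ n) :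
    coeff n (artinHasseFactorLog p y j) = 0 := by
  rw [artinHasseFactorLog, coeff_expand, if_neg fun h => hn ((pow_dvd_pow p hm).trans h)]

omit [CharZero L] in
theorem coeff_artinHasseSum_of_ne (y : ℕ → L) (S : Finset ℕ) {n : ℕ} (hn : ∀ i, n ≠ p ^ i) :
    coeff n (artinHasseSum p y S) = 0 := by
  rw [artinHasseSum, map_sum]
  exact Finset.sum_eq_zero fun j _ => coeff_artinHasseFactorLog_of_ne p _ _ hn

/-- The coordinates `y_j` such that `∑ b_i T ^ (p ^ i)` is the sum of the
`log AH(y_j T ^ (p ^ j))`. -/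
noncomputable def wittCoord (b : ℕ → L) (i : ℕ) : L :=
  b i - ∑ j : Fin i, wittCoord b j ^ p ^ (i - j) / (p : L) ^ (i - j)
termination_by i

omit [CharZero L] hp in
theorem sum_wittCoord (b : ℕ → L) (i : ℕ) :
    ∑ j ∈ Finset.range (i + 1), wittCoord p b j ^ p ^ (i - j) / (p : L) ^ (i - j) = b i := by
  rw [Finset.sum_range_succ, wittCoord.eq_def p b i,
    Fin.sum_univ_eq_sum_range (fun j => wittCoord p b j ^ p ^ (i - j) / (p : L) ^ (i - j))]
  simp

omit [CharZero L] in
theorem coeff_pow_artinHasseSum_wittCoord (b : ℕ → L) {i d : ℕ} (hi : i ≤ d) :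
    coeff (p ^ i) (artinHasseSum p (wittCoord p b) (Finset.range (d + 1))) = b i := by
  rw [artinHasseSum, map_sum]
  simp only [coeff_pow_artinHasseFactorLog]
  rw [← Finset.sum_filter, ← sum_wittCoord p b i]
  congr 1
  ext j
  simp only [Finset.mem_filter, Finset.mem_range]
  omega

end WittCoordinates

/-! ### Coefficients and exponentials of p-typical polynomials -/

section PTypical

variable {K : Type*} [Field K] (p : ℕ) [hp : Fact p.Prime] {d : ℕ} (a : Fin (d + 1) → K)

theorem coeff_pow_pTypical (i : ℕ) :
    (pTypical p d a).coeff (p ^ i) = if h : i < d + 1 then a ⟨i, h⟩ else 0 := by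
  rw [pTypical, Polynomial.finsetSum_coeff]
  simp only [Polynomial.coeff_monomial, (Nat.pow_right_injective hp.out.two_le).eq_iff]
  split_ifs with h
  · rw [Finset.sum_eq_single ⟨i, h⟩]
    · simp
    · intro j _ hj
      rw [if_neg]
      rintro rfl
      exact hj rfl
    · simp
  · refine Finset.sum_eq_zero fun j _ => if_neg ?_
    have := j.2
    omega

omit hp in
theorem coeff_pTypical_of_ne {n : ℕ} (hn : ∀ i, n ≠ p ^ i) : (pTypical p d a).coeff n = 0 := by
  rw [pTypical, Polynomial.finsetSum_coeff]
  exact Finset.sum_eq_zero fun j _ => by rw [Polynomial.coeff_monomial, if_neg (hn j).symm]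

theorem isExpOf_expPoly_pTypical [CharZero K] :
    IsExpOf (pTypical p d a : K⟦X⟧) (expPoly (pTypical p d a)) := by
  refine IsExpOf.subst_exp ?_
  rw [← PowerSeries.coeff_zero_eq_constantCoeff_apply, Polynomial.coeff_coe]
  exact coeff_pTypical_of_ne p a fun i => (pow_pos hp.out.pos i).ne

theorem map_expPoly_pTypical [CharZero K] {L : Type*} [Field L] [CharZero L] (φ : K →+* L) :
    PowerSeries.map φ (expPoly (pTypical p d a)) = expPoly (pTypical p d fun i => φ (a i)) := by
  have h := (isExpOf_expPoly_pTypical p a).map φ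
  rw [← Polynomial.polynomial_map_coe, pTypical, Polynomial.map_sum] at h
  simp only [Polynomial.map_monomial] at h
  exact h.unique (isExpOf_expPoly_pTypical p _)

end PTypical

theorem norm_eq_one_of_isPrimitiveRoot {L : Type*} [NormedField L] {ζ : L} {m : ℕ} (hm : m ≠ 0)
    (hζ : IsPrimitiveRoot ζ m) : ‖ζ‖ = 1 :=
  (pow_eq_one_iff_of_nonneg (norm_nonneg _) hm).1 (by rw [← norm_pow, hζ.pow_eq_one, norm_one])

/-! ### Integrality of the Witt coordinates -/

section Integrality

open PowerSeries Finset

variable {p : ℕ} [hp : Fact p.Prime] {L : Type*} [NormedField L] [IsUltrametricDist L] [CharZero L]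
  [NormedAlgebra ℚ_[p] L]

omit [IsUltrametricDist L] [CharZero L] in
theorem norm_prime_eq : ‖(p : L)‖ = (p : ℝ)⁻¹ := by
  rw [← map_natCast (algebraMap ℚ_[p] L), norm_algebraMap', Padic.norm_p]

omit [IsUltrametricDist L] [CharZero L] in
theorem norm_prime_lt_one : ‖(p : L)‖ < 1 := by
  rw [norm_prime_eq]
  exact inv_lt_one_of_one_lt₀ (by exact_mod_cast hp.out.one_lt)

omit [IsUltrametricDist L] in
theorem norm_coeff_artinHasseFactor_le {y : L} {j : ℕ} {s : ℝ} (hs : 0 ≤ s)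
    (hy : ‖y‖ ≤ s ^ p ^ j) (n : ℕ) : ‖coeff n (artinHasseFactor p y j)‖ ≤ s ^ n := by
  rw [artinHasseFactor, coeff_expand]
  split_ifs with hd
  · obtain ⟨m, rfl⟩ := hd
    rw [Nat.mul_div_cancel_left _ (pow_pos hp.out.pos j), coeff_rescale, norm_mul, norm_pow,
      pow_mul]
    exact (mul_le_of_le_one_right (by positivity) (norm_coeff_artinHasseExp_le (p := p) m)).trans
      (pow_le_pow_left₀ (norm_nonneg _) hy m)
  · simpa using pow_nonneg hs n

theorem norm_coeff_artinHasseProd_le {y : ℕ → L} {S : Finset ℕ} {s : ℝ} (hs : 0 ≤ s)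
    (hy : ∀ j ∈ S, ‖y j‖ ≤ s ^ p ^ j) (n : ℕ) : ‖coeff n (artinHasseProd p y S)‖ ≤ s ^ n :=
  norm_coeff_prod_le S hs (fun j hj => norm_coeff_artinHasseFactor_le hs (hy j hj)) n

omit [NormedAlgebra ℚ_[p] L] [IsUltrametricDist L] in
theorem coeff_pow_artinHasseProd_Ico (y : ℕ → L) {i N : ℕ} (hi : i < N) :
    coeff (p ^ i) (artinHasseProd p y (Ico i N)) = y i := by
  have hlog : ∀ j ∈ Ico i N, j ≠ i → coeff (p ^ i) (artinHasseFactorLog p (y j) j) = 0 := by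
    intro j hj hne
    rw [coeff_pow_artinHasseFactorLog, if_neg]
    have := mem_Ico.1 hj
    omega
  rw [(isExpOf_artinHasseProd p y _).coeff_eq_of_forall_lt (pow_pos hp.out.pos i).ne']
  · rw [artinHasseSum, map_sum, sum_eq_single_of_mem i (by simp [hi]) hlog,
      coeff_pow_artinHasseFactorLog]
    simp
  · intro m hm hm0
    rw [artinHasseSum, map_sum]
    refine sum_eq_zero fun j hj => coeff_artinHasseFactorLog_of_not_dvd p _ (mem_Ico.1 hj).1 ?_
    exact fun h => absurd (Nat.le_of_dvd (Nat.pos_of_ne_zero hm0) h) (not_le.2 hm)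

omit [IsUltrametricDist L] [NormedAlgebra ℚ_[p] L] in
theorem artinHasseProd_range_mul_Ico (y : ℕ → L) {i N : ℕ} (hi : i ≤ N) :
    artinHasseProd p y (range i) * artinHasseProd p y (Ico i N) = artinHasseProd p y (range N) :=
  prod_range_mul_prod_Ico _ hi

/-- The Witt coordinates are integral if the exponential is integral in low degrees. -/
theorem norm_le_one_of_norm_coeff_artinHasseProd_le {y : ℕ → L} {d : ℕ}
    (h : ∀ n ≤ p ^ d, ‖coeff n (artinHasseProd p y (range (d + 1)))‖ ≤ 1) (i : ℕ) (hi : i ≤ d) :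
    ‖y i‖ ≤ 1 := by
  induction i using Nat.strong_induction_on with
  | _ i ih =>
    -- y_i is the first nontrivial coefficient of the tail product, which is the full product
    -- divided by factors already known to be integral.
    rw [← coeff_pow_artinHasseProd_Ico (p := p) y (Nat.lt_succ_of_le hi)]
    have hle : p ^ i ≤ p ^ d := Nat.pow_le_pow_right hp.out.pos hi
    simpa using norm_coeff_le_of_mul (f := artinHasseProd p y (range i)) (s := 1) (C := 1)
      zero_le_one zero_le_one (isExpOf_artinHasseProd p y _).1
      (norm_coeff_artinHasseProd_le zero_le_one fun j hj => by
        rw [one_pow]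
        exact ih j (mem_range.1 hj) (by have := mem_range.1 hj; omega)) (N := p ^ d)
      (fun n hn => by
        rw [artinHasseProd_range_mul_Ico y (by omega)]
        simpa using h n hn) (p ^ i) hle

/-- Strictness before J leaves room for a radius s below N J that still dominates the earlier
factors. -/
theorem exists_first_max (N : ℕ → ℝ) (d : ℕ) :
    ∃ J ≤ d, (∀ j ≤ d, N j ≤ N J) ∧ ∀ j < J, N j < N J := by
  classical
  have hex : ∃ J, J ≤ d ∧ ∀ j ≤ d, N j ≤ N J := by
    obtain ⟨J, hJ, hmax⟩ := exists_max_image (range (d + 1)) N ⟨0, by simp⟩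
    exact ⟨J, by simpa [Nat.lt_succ_iff] using hJ,
      fun j hj => hmax j (by simpa [Nat.lt_succ_iff] using hj)⟩
  obtain ⟨h1, h2⟩ := Nat.find_spec hex
  refine ⟨Nat.find hex, h1, h2, fun j hj => lt_of_not_ge fun hge => Nat.find_min hex hj ?_⟩
  exact ⟨by omega, fun i hi => (h2 i hi).trans hge⟩

/-- The logarithmic derivative of the product of the Artin-Hasse factors has coefficients of
maximal size in the degrees `p ^ i`. -/
theorem norm_coeff_artinHasseSum_Ico {y : ℕ → L} {J d i : ℕ} {r : ℝ} (hr : 0 < r) (hJ : J ≤ d)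
    (hi : d ≤ i) (hyJ : ‖y J‖ = r ^ p ^ J) (hy : ∀ j ≤ d, ‖y j‖ ≤ r ^ p ^ j) :
    ‖((p : L) ^ J)⁻¹ * (p ^ i * coeff (p ^ i) (artinHasseSum p y (Ico J (d + 1))))‖ =
      r ^ p ^ i := by
  have hp0 : (p : L) ≠ 0 := Nat.cast_ne_zero.2 hp.out.ne_zero
  have hterm : ∀ j ∈ Ico J (d + 1), ((p : L) ^ J)⁻¹ *
      (p ^ i * coeff (p ^ i) (artinHasseFactorLog p (y j) j)) =
        (p : L) ^ (j - J) * y j ^ p ^ (i - j) := by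
    intro j hj
    have hj' := mem_Ico.1 hj
    rw [coeff_pow_artinHasseFactorLog, if_pos (by omega)]
    have h1 : (p : L) ^ i = p ^ J * p ^ (j - J) * p ^ (i - j) := by
      rw [← pow_add, ← pow_add]; congr 1; omega
    rw [h1]
    field_simp
  rw [artinHasseSum, map_sum, mul_sum, mul_sum, sum_congr rfl hterm,
    sum_eq_sum_Ico_succ_bot (by omega)]
  have hpow : ∀ j ≤ i, (r ^ p ^ j) ^ p ^ (i - j) = r ^ p ^ i := by
    intro j hj
    rw [← pow_mul, ← pow_add]; congr 2; omega
  have hlead : ‖(p : L) ^ (J - J) * y J ^ p ^ (i - J)‖ = r ^ p ^ i := by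
    rw [Nat.sub_self, pow_zero, one_mul, norm_pow, hyJ, hpow J (by omega)]
  -- Each term with j > J carries a factor p^(j − J), so the term j = J strictly dominates.
  have hrest : ‖∑ j ∈ Ico (J + 1) (d + 1), (p : L) ^ (j - J) * y j ^ p ^ (i - j)‖ < r ^ p ^ i := by
    refine lt_of_le_of_lt (b := ‖(p : L)‖ * r ^ p ^ i)
      (IsUltrametricDist.norm_sum_le_of_forall_le_of_nonneg (by positivity) fun j hj => ?_)
      (mul_lt_of_lt_one_left (by positivity) norm_prime_lt_one)
    have hj' := mem_Ico.1 hj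
    rw [norm_mul, norm_pow, norm_pow, ← hpow j (by omega)]
    refine mul_le_mul (pow_le_of_le_one (norm_nonneg _) norm_prime_lt_one.le (by omega))
      (pow_le_pow_left₀ (norm_nonneg _) (hy j (by omega)) _) (by positivity) (norm_nonneg _)
  rw [IsUltrametricDist.norm_add_eq_max_of_norm_ne_norm (by rw [hlead]; exact hrest.ne'), hlead,
    max_eq_left hrest.le]

/-- In degree n = qm, ζ^n − 1 = (1 + (ζ^q − 1))^m − 1 is m(ζ^q − 1) up to a quadratic error, and
multiplication by m = n/q is the operator q⁻¹ T d/dT. -/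
theorem norm_rescale_sub_sub_le {f : L⟦X⟧} {ζ : L} {q : ℕ} {r : ℝ} (hr : 0 ≤ r) (hq : q ≠ 0)
    (hζ : ‖ζ ^ q - 1‖ ≤ 1) (hf : ∀ n, ‖coeff n f‖ ≤ r ^ n) (hf' : ∀ n, ¬ q ∣ n → coeff n f = 0)
    (n : ℕ) : ‖coeff n (rescale ζ f - f - C ((ζ ^ q - 1) * (q : L)⁻¹) * (X * d⁄dX L f))‖ ≤
      ‖ζ ^ q - 1‖ ^ 2 * r ^ n := by
  rw [map_sub, map_sub, coeff_C_mul, coeff_X_mul_derivative, coeff_rescale]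
  by_cases hd : q ∣ n
  · obtain ⟨m, rfl⟩ := hd
    have hq0 : (q : L) ≠ 0 := Nat.cast_ne_zero.2 hq
    have : ζ ^ (q * m) * coeff (q * m) f - coeff (q * m) f -
        (ζ ^ q - 1) * (q : L)⁻¹ * (((q * m : ℕ) : L) * coeff (q * m) f) =
        ((1 + (ζ ^ q - 1)) ^ m - 1 - m * (ζ ^ q - 1)) * coeff (q * m) f := by
      rw [add_sub_cancel, ← pow_mul]
      push_cast
      field_simp
    rw [this, norm_mul]
    exact mul_le_mul (norm_one_add_pow_sub_le hζ m) (hf _) (norm_nonneg _) (by positivity)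
  · rw [hf' n hd]
    simp only [mul_zero, sub_zero, norm_zero]
    positivity

/-- If `AH(ζ T) / AH(T)`, for a product `AH` of Artin-Hasse factors, has radius of convergence at
least `1`, then `AH` has integral Witt coordinates. -/
theorem norm_le_one_of_rescale_eq {ζ : L} {d : ℕ} (hζ : IsPrimitiveRoot ζ (p ^ (d + 1)))
    {y : ℕ → L} {E : L⟦X⟧}
    (hE : rescale ζ (artinHasseProd p y (range (d + 1))) = artinHasseProd p y (range (d + 1)) * E)
    (hE' : ∀ s : ℝ, 1 < s → ∃ C, ∀ n, ‖coeff n E‖ ≤ C * s ^ n) (i : ℕ) (hi : i ≤ d) :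
    ‖y i‖ ≤ 1 := by
  by_contra! hyi
  have hppos : ∀ j, p ^ j ≠ 0 := fun j => pow_ne_zero j hp.out.ne_zero
  have hζ1 : ‖ζ‖ = 1 := norm_eq_one_of_isPrimitiveRoot (hppos _) hζ
  obtain ⟨N, hN0, hN⟩ : ∃ N : ℕ → ℝ, (∀ j, 0 ≤ N j) ∧ ∀ j, N j ^ p ^ j = ‖y j‖ :=
    ⟨fun j => ‖y j‖ ^ (((p ^ j : ℕ) : ℝ)⁻¹), fun j => by positivity,
      fun j => Real.rpow_inv_natCast_pow (norm_nonneg _) (hppos j)⟩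
  obtain ⟨J, hJd, hmax, hfirst⟩ := exists_first_max N d
  have hr1 : 1 < N J := by
    refine lt_of_lt_of_le ?_ (hmax i hi)
    rw [← hN] at hyi
    exact (one_lt_pow_iff_of_nonneg (hN0 i) (hppos i)).1 hyi
  obtain ⟨s, hs1, hsJ, hsr⟩ : ∃ s, 1 < s ∧ (∀ j ∈ range J, N j < s) ∧ s < N J := by
    have h1 : ∀ᶠ s in nhdsWithin (N J) (Set.Iio (N J)), 1 < s :=
      nhdsWithin_le_nhds (lt_mem_nhds hr1)
    have h2 : ∀ᶠ s in nhdsWithin (N J) (Set.Iio (N J)), ∀ j ∈ range J, N j < s :=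
      (Filter.eventually_all_finset _).2 fun j hj =>
        nhdsWithin_le_nhds (lt_mem_nhds (hfirst j (mem_range.1 hj)))
    exact (h1.and (h2.and self_mem_nhdsWithin)).exists
  set r := N J
  have hr0 : 0 < r := zero_lt_one.trans hr1
  have hs0 : 0 < s := zero_lt_one.trans hs1
  obtain ⟨B, hB⟩ := hE' s hs1
  have hB0 : 0 ≤ B := by simpa using (norm_nonneg _).trans (hB 0)
  set F₀ := artinHasseProd p y (range J) with hF₀
  set F₁ := artinHasseProd p y (Ico J (d + 1)) with hF₁
  have hexp₀ : IsExpOf _ F₀ := isExpOf_artinHasseProd p y (range J)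
  have hexp₁ : IsExpOf _ F₁ := isExpOf_artinHasseProd p y (Ico J (d + 1))
  have hF₁0 : F₁ ≠ 0 := fun h => by simpa [h] using hexp₁.1
  rw [← artinHasseProd_range_mul_Ico y (show J ≤ d + 1 by omega), ← hF₀, ← hF₁, map_mul] at hE
  obtain ⟨H, hH⟩ : ∃ H, F₁ * H = rescale ζ F₁ :=
    ⟨F₁⁻¹ * rescale ζ F₁, by
      rw [← mul_assoc, PowerSeries.mul_inv_cancel _ (by rw [hexp₁.1]; exact one_ne_zero), one_mul]⟩
  -- Cancelling F₁ shows that H = F₀(T) E(T) / F₀(ζT), in which only series of growth s occur.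
  have hHE : rescale ζ F₀ * H = F₀ * E := by
    apply mul_left_cancel₀ hF₁0
    linear_combination (rescale ζ F₀) * hH + hE
  have hF₀s : ∀ n, ‖coeff n F₀‖ ≤ s ^ n := norm_coeff_artinHasseProd_le hs0.le fun j hj => by
    rw [← hN j]
    exact pow_le_pow_left₀ (hN0 j) (hsJ j hj).le _
  have hHs (n : ℕ) : ‖coeff n H‖ ≤ B * s ^ n := by
    refine norm_coeff_le_of_mul (f := rescale ζ F₀) hs0.le hB0 (hexp₀.rescale ζ).1
      (fun n => ?_) (N := n) (fun m _ => ?_) n le_rfl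
    · rw [norm_coeff_rescale_of_norm_eq_one hζ1]
      exact hF₀s n
    · rw [hHE]
      simpa using norm_coeff_mul_le hs0.le zero_le_one hB0 (by simpa using hF₀s) hB m
  have hyr : ∀ j ≤ d, ‖y j‖ ≤ r ^ p ^ j := fun j hj => by
    rw [← hN j]
    exact pow_le_pow_left₀ (hN0 j) (hmax j hj) _
  have hF₁r : ∀ n, ‖coeff n F₁‖ ≤ r ^ n := norm_coeff_artinHasseProd_le hr0.le fun j hj =>
    hyr j (by have := mem_Ico.1 hj; omega)
  have hF₁d : ∀ n, ¬ p ^ J ∣ n → coeff n F₁ = 0 := hexp₁.coeff_eq_zero_of_not_dvd fun n hn => by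
    rw [artinHasseSum, map_sum]
    exact sum_eq_zero fun j hj =>
      coeff_artinHasseFactorLog_of_not_dvd p _ (mem_Ico.1 hj).1 hn
  set π : L := ζ ^ p ^ J - 1 with hπ
  have hπ0 : 0 < ‖π‖ := by
    rw [norm_pos_iff, hπ, sub_ne_zero]
    exact hζ.pow_ne_one_of_pos_of_lt (hppos J) (Nat.pow_lt_pow_right hp.out.one_lt (by omega))
  have hπ1 : ‖π‖ < 1 := norm_sub_one_lt_one_of_pow_eq_one norm_prime_lt_one (m := d + 1) (by
    rw [← pow_mul, mul_comm, pow_mul, hζ.pow_eq_one, one_pow])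
  -- Dividing the first-order expansion of F₁(ζT) by F₁ preserves the error bound |π|² r^n.
  have hbound (n : ℕ) := norm_coeff_le_of_mul (f := F₁)
    (h := H - 1 - C (π * ((p ^ J : ℕ) : L)⁻¹) * (X * d⁄dX L (artinHasseSum p y (Ico J (d + 1)))))
    hr0.le (sq_nonneg ‖π‖) hexp₁.1 hF₁r (N := n) (fun m _ => by
      have h := norm_rescale_sub_sub_le hr0.le (hppos J) hπ1.le hF₁r hF₁d m
      rw [hexp₁.2, ← hH] at h
      convert h using 3
      ring) n le_rfl
  have hlim : Filter.Tendsto (fun n : ℕ => B * (s / r) ^ n) Filter.atTop (nhds 0) := by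
    simpa using (tendsto_pow_atTop_nhds_zero_of_lt_one (by positivity)
      ((div_lt_one hr0).2 hsr)).const_mul B
  obtain ⟨M, hM⟩ := (hlim.eventually (gt_mem_nhds hπ0)).exists_forall_of_atTop
  -- m ≥ d makes every factor contribute in degree p^m; m ≥ M puts p^m where H is negligible.
  let m := max M d
  have hmM : M ≤ p ^ m := (le_max_left M d).trans (Nat.lt_pow_self hp.out.one_lt).le
  have hb := hbound (p ^ m)
  have hH' := hHs (p ^ m)
  have hM' := hM _ hmM
  have hlead := norm_coeff_artinHasseSum_Ico hr0 hJd (le_max_right M d) (hN J).symm hyr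
  rw [map_sub, map_sub, coeff_one, if_neg (hppos m), sub_zero, coeff_C_mul,
    coeff_X_mul_derivative] at hb
  have hrpos : 0 < r ^ p ^ m := by positivity
  have hHlt : ‖coeff (p ^ m) H‖ < ‖π‖ * r ^ p ^ m := by
    refine hH'.trans_lt ?_
    rw [div_pow, ← mul_div_assoc, div_lt_iff₀ hrpos] at hM'
    exact hM'
  have hlast : ‖π * ((p ^ J : ℕ) : L)⁻¹ *
      (((p ^ m : ℕ) : L) * coeff (p ^ m) (artinHasseSum p y (Ico J (d + 1))))‖ =
        ‖π‖ * r ^ p ^ m := by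
    push_cast
    rw [mul_assoc, norm_mul, hlead]
  rw [norm_sub_rev, sub_eq_add_neg, IsUltrametricDist.norm_add_eq_max_of_norm_ne_norm
    (by rw [hlast, norm_neg]; exact hHlt.ne'), hlast, norm_neg, max_eq_left hHlt.le, sq, mul_assoc] at hb
  exact absurd hb (not_le.2 (mul_lt_of_lt_one_left (by positivity) hπ1))

end Integrality

/-! ### Radius of convergence and coefficient growth -/

section Radius

theorem one_le_radiusOfConvergence {K : Type*} [NontriviallyNormedField K] {f : K⟦X⟧}
    (h : ∀ n, ‖PowerSeries.coeff n f‖ ≤ 1) : 1 ≤ radiusOfConvergence f := by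
  have := (FormalMultilinearSeries.ofScalars K fun n =>
    PowerSeries.coeff n f).le_radius_of_bound 1 (r := 1) fun n => by
      rw [FormalMultilinearSeries.ofScalars_norm]
      simpa using h n
  simpa [radiusOfConvergence] using this

theorem exists_norm_coeff_le_of_one_le_radiusOfConvergence {K : Type*} [NontriviallyNormedField K]
    {f : K⟦X⟧} (h : 1 ≤ radiusOfConvergence f) {s : ℝ} (hs : 1 < s) :
    ∃ C, ∀ n, ‖PowerSeries.coeff n f‖ ≤ C * s ^ n := by
  have hs0 : 0 < s := zero_lt_one.trans hs
  let t : NNReal := ⟨s⁻¹, by positivity⟩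
  have ht : (t : ENNReal) < radiusOfConvergence f := by
    refine lt_of_lt_of_le ?_ h
    rw [ENNReal.coe_lt_one_iff, ← NNReal.coe_lt_coe]
    exact inv_lt_one_of_one_lt₀ hs
  obtain ⟨C, -, hC⟩ := FormalMultilinearSeries.norm_mul_pow_le_of_lt_radius _ ht
  refine ⟨C, fun n => ?_⟩
  have := hC n
  rw [FormalMultilinearSeries.ofScalars_norm] at this
  change _ * (s⁻¹) ^ n ≤ C at this
  rwa [inv_pow, ← div_eq_mul_inv, div_le_iff₀ (by positivity)] at this

end Radius

/-! ### The twisted polynomial and the equivalence -/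

section Main

open PowerSeries Finset

variable {p : ℕ} [hp : Fact p.Prime] {L : Type*} [Field L] [CharZero L] {d : ℕ}
  {ζ : L} (a : Fin (d + 1) → L)

/-- The Witt coordinates of `∑ a_i / (ζ ^ (p ^ i) - 1) T ^ (p ^ i)`. -/
noncomputable def twistedWittCoord (p : ℕ) (ζ : L) (a : Fin (d + 1) → L) : ℕ → L :=
  wittCoord p fun i => if h : i < d + 1 then a ⟨i, h⟩ / (ζ ^ p ^ i - 1) else 0

theorem coeff_artinHasseProd_twistedWittCoord {n : ℕ} (hn : n ≤ p ^ d) :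
    coeff n (artinHasseProd p (twistedWittCoord p ζ a) (range (d + 1))) =
      coeff n (expPoly (pTypical p d fun i => a i / (ζ ^ p ^ (i : ℕ) - 1))) := by
  refine (isExpOf_artinHasseProd p _ _).coeff_congr (isExpOf_expPoly_pTypical p _) (p ^ d)
    (fun n hn _ => ?_) n hn
  rw [Polynomial.coeff_coe]
  by_cases h : ∃ i, n = p ^ i
  · obtain ⟨i, rfl⟩ := h
    rw [twistedWittCoord, coeff_pow_artinHasseSum_wittCoord _ _
      ((Nat.pow_le_pow_iff_right hp.out.one_lt).1 hn), coeff_pow_pTypical]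
  · push Not at h
    rw [coeff_artinHasseSum_of_ne p _ _ h, coeff_pTypical_of_ne p _ h]

/-- No truncation is needed here, although log F has terms beyond P̃: those of degree p^i with i > d
are fixed by T ↦ ζT. -/
theorem rescale_artinHasseProd_twistedWittCoord (hζ : IsPrimitiveRoot ζ (p ^ (d + 1))) :
    rescale ζ (artinHasseProd p (twistedWittCoord p ζ a) (range (d + 1))) =
      artinHasseProd p (twistedWittCoord p ζ a) (range (d + 1)) * expPoly (pTypical p d a) := by
  have h := isExpOf_artinHasseProd p (twistedWittCoord p ζ a) (range (d + 1))
  refine (h.rescale ζ).unique ?_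
  convert h.mul (isExpOf_expPoly_pTypical p a) using 1
  ext n
  rw [map_add, coeff_rescale, Polynomial.coeff_coe]
  by_cases h : ∃ i, n = p ^ i
  · obtain ⟨i, rfl⟩ := h
    rw [coeff_pow_pTypical]
    split_ifs with hi
    · have hne : ζ ^ p ^ i - 1 ≠ 0 := sub_ne_zero.2 <|
        hζ.pow_ne_one_of_pos_of_lt (pow_pos hp.out.pos i).ne'
          (Nat.pow_lt_pow_right hp.out.one_lt hi)
      rw [twistedWittCoord, coeff_pow_artinHasseSum_wittCoord _ _ (by omega), dif_pos hi]
      field_simp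
      ring
    · have : ζ ^ p ^ i = 1 := by
        rw [show i = d + 1 + (i - (d + 1)) by omega, pow_add, pow_mul, hζ.pow_eq_one, one_pow]
      rw [this, one_mul, add_zero]
  · push Not at h
    rw [coeff_artinHasseSum_of_ne p _ _ h, coeff_pTypical_of_ne p _ h, mul_zero, add_zero]

theorem mem_integersAdjoin {K L : Type*} [NormedField K] [NormedField L] [IsUltrametricDist L]
    [NormedAlgebra K L] (ζ x : L) : x ∈ integersAdjoin K ζ ↔ ‖x‖ ≤ 1 ∧ x ∈ K⟮ζ⟯ := by
  rw [integersAdjoin, Subring.mem_inf, mem_integers]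
  rfl

theorem coeff_expPoly_pTypical_mem_adjoin {K : Type*} [Field K] [Algebra K L] (ζ : L)
    (a : Fin (d + 1) → K) (n : ℕ) :
    coeff n (expPoly (pTypical p d fun i => algebraMap K L (a i) / (ζ ^ p ^ (i : ℕ) - 1))) ∈
      K⟮ζ⟯ := by
  refine (isExpOf_expPoly_pTypical p _).coeff_mem (S := K⟮ζ⟯.toSubfield) (fun n => ?_) n
  rw [Polynomial.coeff_coe, pTypical, Polynomial.finsetSum_coeff]
  refine Subfield.sum_mem _ fun i _ => ?_
  rw [Polynomial.coeff_monomial]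
  split_ifs
  · exact div_mem (K⟮ζ⟯.algebraMap_mem _)
      (sub_mem (pow_mem (IntermediateField.mem_adjoin_simple_self K ζ) _) (one_mem K⟮ζ⟯))
  · exact zero_mem K⟮ζ⟯

end Main

theorem mainTheorem2 (p : ℕ) [Fact p.Prime]
    {K : Type*} [NontriviallyNormedField K] [IsUltrametricDist K] [CharZero K]
    [NormedAlgebra ℚ_[p] K]
    {L : Type*} [NormedField L] [IsUltrametricDist L] [CharZero L]
    [NormedAlgebra K L] [FiniteDimensional K L]
    (d : ℕ) (ζ : L) (hζ : IsPrimitiveRoot ζ (p ^ (d + 1)))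
    (a : Fin (d + 1) → K) :
    List.TFAE [
      1 ≤ radiusOfConvergence (expPoly (pTypical p d a)),
      ∀ n : ℕ, PowerSeries.coeff n (expPoly (pTypical p d a)) ∈ integers K,
      ∀ n : ℕ, n ≤ p ^ d →
        PowerSeries.coeff n (expPoly (pTypical p d
          (fun i => algebraMap K L (a i) / (ζ ^ p ^ (i : ℕ) - 1)))) ∈ integersAdjoin K ζ] := by
  let _ : NormedAlgebra ℚ_[p] L := NormedAlgebra.restrictScalars ℚ_[p] K L
  have hnorm (n : ℕ) : ‖PowerSeries.coeff n (expPoly (pTypical p d fun i => algebraMap K L (a i)))‖ =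
      ‖PowerSeries.coeff n (expPoly (pTypical p d a))‖ := by
    rw [← map_expPoly_pTypical p a (algebraMap K L), PowerSeries.coeff_map, norm_algebraMap']
  have hres := rescale_artinHasseProd_twistedWittCoord (fun i => algebraMap K L (a i)) hζ
  have hζ1 : ‖ζ‖ = 1 :=
    norm_eq_one_of_isPrimitiveRoot (pow_ne_zero _ (Fact.out : p.Prime).ne_zero) hζ
  have hprod (h : ∀ j ≤ d, ‖twistedWittCoord p ζ (fun i => algebraMap K L (a i)) j‖ ≤ 1) (n : ℕ) :
      ‖PowerSeries.coeff n (artinHasseProd p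
        (twistedWittCoord p ζ fun i => algebraMap K L (a i)) (Finset.range (d + 1)))‖ ≤ 1 ^ n :=
    norm_coeff_artinHasseProd_le zero_le_one (fun j hj => by
      rw [one_pow]
      exact h j (Nat.lt_succ_iff.1 (Finset.mem_range.1 hj))) n
  tfae_have 2 → 1 := fun h => one_le_radiusOfConvergence fun n => (mem_integers _).1 (h n)
  tfae_have 1 → 3 := by
    intro h n hn
    rw [mem_integersAdjoin]
    refine ⟨?_, coeff_expPoly_pTypical_mem_adjoin ζ a n⟩
    rw [← coeff_artinHasseProd_twistedWittCoord _ hn]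
    refine (hprod (norm_le_one_of_rescale_eq hζ hres fun s hs => ?_) n).trans (one_pow n).le
    simp only [hnorm]
    exact exists_norm_coeff_le_of_one_le_radiusOfConvergence h hs
  tfae_have 3 → 2 := by
    intro h n
    have hy := norm_le_one_of_norm_coeff_artinHasseProd_le (p := p) (d := d)
      (y := twistedWittCoord p ζ fun i => algebraMap K L (a i)) fun n hn => by
        rw [coeff_artinHasseProd_twistedWittCoord _ hn]
        exact ((mem_integersAdjoin ζ _).1 (h n hn)).1
    rw [mem_integers, ← hnorm]
    -- exp(P) is the quotient F(ζT)/F(T) of integral series, and F has constant term 1.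
    simpa using norm_coeff_le_of_mul zero_le_one zero_le_one (isExpOf_artinHasseProd p _ _).1
      (hprod hy) (N := n) (fun m _ => by
        rw [← hres, norm_coeff_rescale_of_norm_eq_one hζ1, one_mul]
        exact hprod hy m) n le_rfl
  tfae_finish
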